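/- For every $K_y\in\mathbb{N}$ there is a constant $r>0$, depending only on $K_y$, such that the following holds. Let $\mathcal{X}\subseteq\mathbb{R}^d$ be measurable and let $\mathcal{Y}$ be a finite set with $|\mathcal{Y}|=K_y$. Let $(x_i,y_i)_{i\ge 1}$ be i.i.d. from a probability distribution $\mathbb{P}$ on $\mathcal{X}\times\mathcal{Y}$ whose $x$-marginal is absolutely continuous with respect to Lebesgue measure. Let $p(x,y)$ be the joint density of $\mathbb{P}$ (Lebesgue measure in $x$, counting measure in $y$), with $x$-marginal $p^x(x)=\sum_{y}p(x,y)$. Let $\{f_\theta(\cdot|x):\theta\in\Theta\}$ be a family of conditional probability mass functions on $\mathcal{Y}$ given $x\in\mathcal{X}$, and put $p_\theta(x,y)=f_\theta(y|x)\,p^x(x)$. Let $K:\mathbb{R}^d\to[0,\infty)$ be measurable with $\int_{\mathbb{R}^d} K(u)\,du=1$, and let $h_n>0$ satisfy $h_n\to 0$ and $n h_n^d\to\infty$ as $n\to\infty$ (for $d=1$ this is $n h_n\to\infty$). Define $$\widehat p^{\,h_n}_n(x,y)=\frac1n\sum_{i=1}^n \mathbf 1\{y_i=y\}\,\frac1{h_n^d}K\!\left(\frac{x_i-x}{h_n}\right),\qquad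 \widehat p^{\,x,h_n}_n(x)=\sum_{y\in\mathcal{Y}}\widehat p^{\,h_n}_n(x,y),\qquad \widehat p_{\theta,n,h_n}(x,y)=f_\theta(y|x)\,\widehat p^{\,x,h_n}_n(x),$$ and, for joint densities $g,g'$, $\mathrm{TVD}(g,g')=\frac12\sum_{y\in\mathcal{Y}}\int_{\mathcal{X}}|g(x,y)-g'(x,y)|\,dx$. Let $n_y=\#\{i\le n: y_i=y\}$ and $\delta_n=\exp\{-r\,\varepsilon^2\min_{y\in\mathcal{Y}}n_y\}$. Then for every $\varepsilon>0$ there is an $N$ such that for all $n\ge N$ and all $\theta\in\Theta$, $$\left|\mathrm{TVD}(\widehat p^{\,h_n}_n,\widehat p_{\theta,n,h_n})-\mathrm{TVD}(p,p_\theta)\right|<\varepsilon$$ with probability at least $1-\delta_n$, whatever the realized value of the label counts $n_y$ that enter $\delta_n$: that is, the (unconditional) probability of this event is at least $1-\delta_n(\omega)$ for every outcome $\omega$. -/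

import Mathlib

open MeasureTheory ProbabilityTheory Filter Topology

noncomputable section

/-- The total variation distance `(1/2) ∑_y ∫_𝒳 |g(x,y) - g'(x,y)| dx` between two joint densities
on `𝒳 × 𝒴`, taken with respect to Lebesgue measure on `𝒳 ⊆ ℝ^d` and counting measure on `𝒴`. -/
def tvd {d : ℕ} {𝒴 : Type*} [Fintype 𝒴] (𝒳 : Set (EuclideanSpace ℝ (Fin d)))
    (g g' : EuclideanSpace ℝ (Fin d) → 𝒴 → ℝ) : ℝ :=
  (1 / 2) * ∑ y, ∫ x in 𝒳, |g x y - g' x y|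

/-- The `x`-marginal `∑_y g(x,y)` of a joint density. -/
def xMarginal {d : ℕ} {𝒴 : Type*} [Fintype 𝒴]
    (g : EuclideanSpace ℝ (Fin d) → 𝒴 → ℝ) (x : EuclideanSpace ℝ (Fin d)) : ℝ :=
  ∑ y, g x y

/-- The joint density `f(y|x) g^x(x)`, where `g^x` is the `x`-marginal of `g`. -/
def modelJoint {d : ℕ} {𝒴 : Type*} [Fintype 𝒴]
    (f : 𝒴 → EuclideanSpace ℝ (Fin d) → ℝ) (g : EuclideanSpace ℝ (Fin d) → 𝒴 → ℝ)
    (x : EuclideanSpace ℝ (Fin d)) (y : 𝒴) : ℝ :=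
  f y x * xMarginal g x

/-- The joint density `p(x,y)` of a law `P` with respect to Lebesgue measure times counting
measure. -/
def jointDensity {d : ℕ} {𝒴 : Type*} [MeasurableSpace 𝒴]
    (P : Measure (EuclideanSpace ℝ (Fin d) × 𝒴)) (x : EuclideanSpace ℝ (Fin d)) (y : 𝒴) : ℝ :=
  (P.rnDeriv ((volume : Measure (EuclideanSpace ℝ (Fin d))).prod Measure.count) (x, y)).toReal

open Classical in
/-- The kernel-smoothed joint estimator
`(1/n) ∑_i δ_{y_i}(y) h^{-d} K((x_i - x)/h)` built from the first `n` sample points. -/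
def kde {d : ℕ} {𝒴 : Type*} (K : EuclideanSpace ℝ (Fin d) → ℝ) (h : ℝ) (n : ℕ)
    (xs : ℕ → EuclideanSpace ℝ (Fin d)) (ys : ℕ → 𝒴)
    (x : EuclideanSpace ℝ (Fin d)) (y : 𝒴) : ℝ :=
  (1 / (n : ℝ)) * ∑ i ∈ Finset.range n,
    (if ys i = y then (1 : ℝ) else 0) * ((1 / h ^ d) * K (h⁻¹ • (xs i - x)))

open Classical in
/-- `n_y`: how many of the first `n` labels equal `y`. -/
def labelCount {𝒴 : Type*} (n : ℕ) (ys : ℕ → 𝒴) (y : 𝒴) : ℕ :=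
  ((Finset.range n).filter (fun i => ys i = y)).card

/-- `min_y n_y`. -/
def minLabelCount {𝒴 : Type*} (n : ℕ) (ys : ℕ → 𝒴) : ℕ :=
  ⨅ y, labelCount n ys y

end

/-! The map sending a joint density `g` to its distance from `f_θ(y|x) g^x(x)` is 1-Lipschitz in
`L¹`, uniformly in `θ`: replacing `g` by `g'` moves both arguments of the distance, each by at most
`‖g - g'‖₁` because `f_θ(·|x)` has mass one, and the factor `1/2` absorbs the two contributions
(`abs_tvd_modelJoint_sub_le`). So it is enough to control the `L¹` error of the kernel estimator, in
which `θ` does not appear.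

Changing one sample point moves that error by at most `2/n`, since each kernel has mass one.
McDiarmid's inequality then bounds the probability of exceeding the mean by `ε/2` by `exp(-n ε²/8)`
(`measureReal_integral_abs_average_sub_le`). The mean error tends to zero
(`eventually_integral_error_le`): the bias vanishes because translations are continuous in `L¹`, and
the fluctuation is handled by truncating `K` at a level `M`, estimating the variance on a set of
finite measure and using a first-moment bound elsewhere; the variance term is of order `M / (n
h^d)`.

Finally `min_y n_y ≤ n` for every outcome, so `exp(-n ε²/8) ≤ δ_n` with `r = 1/8`, whatever the
counts and whatever `K_y`. -/

/-! ### McDiarmid's inequality. -/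

/-- Hoeffding's lemma for a function whose oscillation is at most `c`. -/
lemma integral_exp_mul_sub_integral_le_of_oscillation {Z : Type*} [MeasurableSpace Z]
    {P : Measure Z} [IsProbabilityMeasure P] {G : Z → ℝ} (hG : Measurable G) {c : ℝ}
    (hc : ∀ a b, G a - G b ≤ c) (s : ℝ) :
    ∫ a, Real.exp (s * (G a - ∫ b, G b ∂P)) ∂P ≤ Real.exp (c ^ 2 * s ^ 2 / 8) := by
  obtain ⟨a₀⟩ : Nonempty Z := nonempty_of_isProbabilityMeasure P
  have hbdd : BddBelow (Set.range G) := by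
    refine ⟨G a₀ - c, ?_⟩
    rintro _ ⟨b, rfl⟩
    linarith [hc a₀ b]
  have hmem : ∀ a, G a ∈ Set.Icc (⨅ b, G b) ((⨅ b, G b) + c) := by
    intro a
    have : Nonempty Z := ⟨a₀⟩
    refine ⟨ciInf_le hbdd a, ?_⟩
    have : G a - c ≤ ⨅ b, G b := le_ciInf fun b => by linarith [hc a b]
    linarith
  have h := (hasSubgaussianMGF_of_mem_Icc (μ := P) hG.aemeasurable
    (Eventually.of_forall hmem)).mgf_le s
  refine h.trans (le_of_eq ?_)
  congr 1
  simp only [add_sub_cancel_left, NNReal.coe_pow, NNReal.coe_div, coe_nnnorm, NNReal.coe_ofNat,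
    Real.norm_eq_abs, div_pow, sq_abs]
  ring

/-- Fubini after splitting off the first coordinate; this drives the induction on `n` in McDiarmid's
inequality. -/
lemma integral_pi_succ {Z : Type*} [MeasurableSpace Z] (P : Measure Z) [IsProbabilityMeasure P]
    {n : ℕ} {F : (Fin (n + 1) → Z) → ℝ} (hF : Integrable F (Measure.pi fun _ => P)) :
    ∫ z, F z ∂(Measure.pi fun _ => P) =
      ∫ a, ∫ z, F (Fin.cons a z) ∂(Measure.pi fun _ : Fin n => P) ∂P := by
  have mp := (measurePreserving_piFinSuccAbove (fun _ : Fin (n + 1) => P) 0).symm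
  have h1 := mp.integral_comp (MeasurableEquiv.measurableEmbedding _) F
  rw [← h1, integral_prod]
  · simp [MeasurableEquiv.piFinSuccAbove, Fin.consEquiv]
  · exact (mp.integrable_comp_emb (MeasurableEquiv.measurableEmbedding _)).2 hF

/-- McDiarmid's inequality, in the form of a bound on the moment generating function. -/
lemma integral_exp_mul_sub_integral_le_of_boundedDifferences {Z : Type*} [MeasurableSpace Z]
    (P : Measure Z) [IsProbabilityMeasure P] {c C : ℝ} (s : ℝ) (n : ℕ)
    (F : (Fin n → Z) → ℝ) (hF : Measurable F) (hC : ∀ z, |F z| ≤ C)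
    (hc : ∀ z i v, |F (Function.update z i v) - F z| ≤ c) :
    ∫ z, Real.exp (s * (F z - ∫ z, F z ∂(Measure.pi fun _ => P))) ∂(Measure.pi fun _ => P) ≤
      Real.exp (n * c ^ 2 * s ^ 2 / 8) := by
  have hexp : ∀ {α : Type _} [MeasurableSpace α] (Q : Measure α) [IsProbabilityMeasure Q]
      (H : α → ℝ) (D : ℝ), Measurable H → (∀ a, |H a| ≤ D) →
      ∀ b, Integrable (fun a => Real.exp (s * (H a - b))) Q := by
    intro α _ Q _ H D hH hD b
    refine Integrable.of_bound (by fun_prop) (Real.exp (|s| * (D + |b|)))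
      (Eventually.of_forall fun a => ?_)
    rw [Real.norm_eq_abs, Real.abs_exp]
    refine Real.exp_le_exp.2 ((le_abs_self _).trans ?_)
    rw [abs_mul]
    gcongr
    exact (abs_sub _ _).trans (add_le_add (hD a) le_rfl)
  induction n with
  | zero =>
    have : ∀ z : Fin 0 → Z, F z = F default := fun z => by rw [Subsingleton.elim z default]
    simp [this]
  | succ n ih =>
    have hFi : Integrable F (Measure.pi fun _ => P) :=
      Integrable.of_bound hF.aestronglyMeasurable C (Eventually.of_forall hC)
    have hcons : Measurable fun q : Z × (Fin n → Z) => (Fin.cons q.1 q.2 : Fin (n + 1) → Z) := by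
      refine measurable_pi_lambda _ fun i => ?_
      refine Fin.cases ?_ (fun j => ?_) i
      · simpa using measurable_fst
      · simpa [Function.comp_def] using
          (measurable_pi_apply (X := fun _ : Fin n => Z) j).comp (measurable_snd (α := Z))
    set m := ∫ z, F z ∂(Measure.pi fun _ => P) with hm
    set G : Z → ℝ := fun a => ∫ z, F (Fin.cons a z) ∂(Measure.pi fun _ : Fin n => P) with hGdef
    have hmG : m = ∫ a, G a ∂P := integral_pi_succ P hFi
    have hsm : ∀ a, Measurable fun z : Fin n → Z => F (Fin.cons a z) := fun a =>
      hF.comp (hcons.comp measurable_prodMk_left)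
    have hsi : ∀ a, Integrable (fun z : Fin n → Z => F (Fin.cons a z))
        (Measure.pi fun _ : Fin n => P) := fun a =>
      Integrable.of_bound (hsm a).aestronglyMeasurable C (Eventually.of_forall fun z => hC _)
    have hG : Measurable G := by
      have : StronglyMeasurable fun q : Z × (Fin n → Z) => F (Fin.cons q.1 q.2) :=
        (hF.comp hcons).stronglyMeasurable
      exact this.integral_prod_right.measurable
    -- Averaging over the remaining coordinates preserves the bounded difference in the first one,
    -- so Hoeffding's lemma applies to `G`.
    have hGc : ∀ a b, G a - G b ≤ c := by
      intro a b
      rw [hGdef]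
      dsimp only
      rw [← integral_sub (hsi a) (hsi b)]
      calc _ ≤ ∫ z : Fin n → Z, c ∂(Measure.pi fun _ : Fin n => P) := by
            refine integral_mono ((hsi a).sub (hsi b)) (integrable_const _) fun z => ?_
            have := hc (Fin.cons b z) 0 a
            rw [Fin.update_cons_zero] at this
            exact (le_abs_self _).trans this
        _ = c := by simp
    have hGC : ∀ a, |G a| ≤ C := fun a => by
      have := norm_integral_le_of_norm_le_const (μ := Measure.pi fun _ : Fin n => P)
        (f := fun z => F (Fin.cons a z)) (C := C) (Eventually.of_forall fun z => hC _)
      simpa using this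
    rw [integral_pi_succ P (hexp _ F C hF hC m)]
    -- Write `F - m = (F - G a) + (G a - m)`: given `a`, the first part is centred and falls to the
    -- induction hypothesis, the second to Hoeffding's lemma.
    calc _ = ∫ a, (∫ z, Real.exp (s * (F (Fin.cons a z) - G a))
              ∂(Measure.pi fun _ : Fin n => P)) * Real.exp (s * (G a - m)) ∂P := by
          congr 1 with a
          rw [← integral_mul_const]
          congr 1 with z
          rw [← Real.exp_add]
          congr 1
          ring
      _ ≤ ∫ a, Real.exp (n * c ^ 2 * s ^ 2 / 8) * Real.exp (s * (G a - m)) ∂P := by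
          refine integral_mono_of_nonneg (Eventually.of_forall fun a => by positivity)
            ((hexp P G C hG hGC m).const_mul _) (Eventually.of_forall fun a => ?_)
          refine mul_le_mul_of_nonneg_right ?_ (Real.exp_nonneg _)
          refine ih (fun z => F (Fin.cons a z)) (hsm a) (fun z => hC _) fun z i v => ?_
          rw [Fin.cons_update]
          exact hc _ _ _
      _ ≤ Real.exp (n * c ^ 2 * s ^ 2 / 8) * Real.exp (c ^ 2 * s ^ 2 / 8) := by
          rw [integral_const_mul, hmG]
          gcongr
          exact integral_exp_mul_sub_integral_le_of_oscillation hG hGc s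
      _ = _ := by
          rw [← Real.exp_add]
          congr 1
          push_cast
          ring

/-- McDiarmid's inequality for a function of `n` i.i.d. points whose differences are bounded by
`2 / n`. -/
lemma measureReal_le_of_boundedDifferences {Z : Type*} [MeasurableSpace Z]
    (P : Measure Z) [IsProbabilityMeasure P] {C : ℝ} {n : ℕ} (hn : 0 < n)
    (F : (Fin n → Z) → ℝ) (hF : Measurable F) (hC : ∀ z, |F z| ≤ C)
    (hc : ∀ z i v, |F (Function.update z i v) - F z| ≤ 2 / n) {t : ℝ} (ht : 0 ≤ t) :
    (Measure.pi fun _ => P).real {z | (∫ z, F z ∂(Measure.pi fun _ => P)) + t ≤ F z} ≤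
      Real.exp (-(n * t ^ 2 / 2)) := by
  set Q : Measure (Fin n → Z) := Measure.pi fun _ => P
  set m := ∫ z, F z ∂Q
  have hn' : (0 : ℝ) < n := by exact_mod_cast hn
  -- With `c = 2 / n` the Chernoff exponent is `-s t + s² / (2 n)`, minimal at `s = n t`.
  have h := integral_exp_mul_sub_integral_le_of_boundedDifferences P (n * t) n F hF hC hc
  have hint : Integrable (fun z => Real.exp (n * t * (F z - m))) Q := by
    refine Integrable.of_bound (by fun_prop) (Real.exp (n * t * (C + |m|)))
      (Eventually.of_forall fun a => ?_)
    rw [Real.norm_eq_abs, Real.abs_exp]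
    refine Real.exp_le_exp.2 ?_
    gcongr
    linarith [le_abs_self (F a), hC a, neg_abs_le m]
  have hch := measure_ge_le_exp_mul_mgf (μ := Q) (X := fun z => F z - m) (t := n * t) t
    (by positivity) hint
  have hset : {z | m + t ≤ F z} = {z | t ≤ F z - m} := by
    ext z
    simp only [Set.mem_ofPred_eq]
    constructor <;> intro h <;> linarith
  rw [hset]
  refine hch.trans ?_
  calc _ ≤ Real.exp (-(n * t) * t) * Real.exp (n * (2 / n) ^ 2 * (n * t) ^ 2 / 8) := by
        gcongr
        exact h
    _ = _ := by
        rw [← Real.exp_add]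
        congr 1
        field_simp
        ring

/-! ### Moments of empirical means. -/

lemma integral_comp_eval_pi {Z : Type*} [MeasurableSpace Z] (P : Measure Z)
    [IsProbabilityMeasure P] {n : ℕ} {φ : Z → ℝ} (hφ : AEStronglyMeasurable φ P) (i : Fin n) :
    ∫ z, φ (z i) ∂(Measure.pi fun _ : Fin n => P) = ∫ a, φ a ∂P := by
  have mp := measurePreserving_eval (fun _ : Fin n => P) i
  have h := integral_map (f := φ) mp.measurable.aemeasurable (mp.map_eq.symm ▸ hφ)
  rw [mp.map_eq] at h
  exact h.symm

lemma integrable_comp_eval_pi {Z : Type*} [MeasurableSpace Z] (P : Measure Z)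
    [IsProbabilityMeasure P] {n : ℕ} {φ : Z → ℝ} (hφ : Integrable φ P) (i : Fin n) :
    Integrable (fun z => φ (z i)) (Measure.pi fun _ : Fin n => P) :=
  (measurePreserving_eval (fun _ : Fin n => P) i).integrable_comp_of_integrable hφ

lemma integral_average_pi {Z : Type*} [MeasurableSpace Z] (P : Measure Z)
    [IsProbabilityMeasure P] {n : ℕ} (hn : 0 < n) {φ : Z → ℝ} (hφ : Integrable φ P) :
    ∫ z, (1 / n : ℝ) * ∑ i, φ (z i) ∂(Measure.pi fun _ : Fin n => P) = ∫ a, φ a ∂P := by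
  have hn' : (n : ℝ) ≠ 0 := by exact_mod_cast hn.ne'
  rw [integral_const_mul, integral_finsetSum _ fun i _ => integrable_comp_eval_pi P hφ i]
  simp_rw [integral_comp_eval_pi P hφ.aestronglyMeasurable]
  simp only [Finset.sum_const, Finset.card_univ, Fintype.card_fin, nsmul_eq_mul]
  field_simp

/-- The mean absolute deviation of an empirical mean is at most twice the first moment. -/
lemma integral_abs_average_sub_le_two_mul {Z : Type*} [MeasurableSpace Z] (P : Measure Z)
    [IsProbabilityMeasure P] {n : ℕ} (hn : 0 < n) {φ : Z → ℝ} (hφ : Integrable φ P)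
    (h0 : ∀ a, 0 ≤ φ a) :
    ∫ z, |(1 / n : ℝ) * ∑ i, φ (z i) - ∫ a, φ a ∂P| ∂(Measure.pi fun _ : Fin n => P) ≤
      2 * ∫ a, φ a ∂P := by
  have hI : Integrable (fun z => (1 / n : ℝ) * ∑ i, φ (z i)) (Measure.pi fun _ : Fin n => P) :=
    (integrable_finsetSum _ fun i _ => integrable_comp_eval_pi P hφ i).const_mul _
  calc _ ≤ ∫ z, ((1 / n : ℝ) * ∑ i, φ (z i) + ∫ a, φ a ∂P) ∂(Measure.pi fun _ : Fin n => P) := by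
        refine integral_mono (hI.sub (integrable_const _)).abs (hI.add (integrable_const _))
          fun z => ?_
        refine (abs_sub _ _).trans (le_of_eq ?_)
        rw [abs_of_nonneg (mul_nonneg (by positivity) (Finset.sum_nonneg fun i _ => h0 _)),
          abs_of_nonneg (integral_nonneg h0)]
    _ = _ := by
        rw [integral_add hI (integrable_const _), integral_average_pi P hn hφ]
        simp
        ring

/-- The variance of an empirical mean of a function with values in `[0, C]`. -/
lemma integral_sq_average_sub_le {Z : Type*} [MeasurableSpace Z] (P : Measure Z)
    [IsProbabilityMeasure P] {n : ℕ} (hn : 0 < n) {φ : Z → ℝ} (hφ : Measurable φ)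
    (h0 : ∀ a, 0 ≤ φ a) {C : ℝ} (hC : ∀ a, φ a ≤ C) :
    ∫ z, ((1 / n : ℝ) * ∑ i, φ (z i) - ∫ a, φ a ∂P) ^ 2 ∂(Measure.pi fun _ : Fin n => P) ≤
      C / n * ∫ a, φ a ∂P := by
  have hn' : (0 : ℝ) < n := by exact_mod_cast hn
  have hL : MemLp φ 2 P := MemLp.of_bound hφ.aestronglyMeasurable C
    (Eventually.of_forall fun a => by rw [Real.norm_eq_abs, abs_of_nonneg (h0 a)]; exact hC a)
  have hφi : Integrable φ P := hL.integrable (by norm_num)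
  set Q : Measure (Fin n → Z) := Measure.pi fun _ => P with hQ
  have hind : iIndepFun (fun i (z : Fin n → Z) => φ (z i)) Q :=
    iIndepFun_pi fun _ => hφ.aemeasurable
  have hLi : ∀ i, MemLp (fun z : Fin n → Z => φ (z i)) 2 Q := fun i =>
    hL.comp_measurePreserving (measurePreserving_eval (fun _ : Fin n => P) i)
  have hvar : ∀ i, Var[fun z : Fin n → Z => φ (z i); Q] ≤ C * ∫ a, φ a ∂P := by
    intro i
    refine (variance_le_expectation_sq (hLi i).1).trans ?_
    have h1 : Q[(fun z : Fin n → Z => φ (z i)) ^ 2] = ∫ a, φ a ^ 2 ∂P :=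
      integral_comp_eval_pi P (φ := fun a => φ a ^ 2) (hφ.pow_const 2).aestronglyMeasurable i
    rw [h1, ← integral_const_mul]
    -- Since `0 ≤ φ ≤ C`, `φ² ≤ C φ`; the variance is thus bounded linearly in the mean.
    refine integral_mono hL.integrable_sq (hφi.const_mul _) fun a => ?_
    simp only [pow_two]
    exact mul_le_mul_of_nonneg_right (hC a) (h0 a)
  have hmean := integral_average_pi P hn hφi
  have hm : AEMeasurable (fun z : Fin n → Z => (1 / n : ℝ) * ∑ i, φ (z i)) Q :=
    Measurable.aemeasurable (by fun_prop)
  rw [← hmean, ← variance_eq_integral hm, variance_const_mul]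
  have hsum := IndepFun.variance_sum (s := Finset.univ) (fun i _ => hLi i)
    (fun i _ j _ hij => hind.indepFun hij)
  have hfun : (∑ i, fun z : Fin n → Z => φ (z i)) = fun z => ∑ i, φ (z i) := by
    ext z; simp
  rw [hfun] at hsum
  rw [hsum]
  calc _ ≤ (1 / n : ℝ) ^ 2 * ∑ i : Fin n, C * ∫ a, φ a ∂P := by
        gcongr with i
        exact hvar i
    _ = C / n * ∫ z, (1 / n : ℝ) * ∑ i, φ (z i) ∂Q := by
        rw [hmean]
        simp only [Finset.sum_const, Finset.card_univ, Fintype.card_fin, nsmul_eq_mul]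
        field_simp

/-- From `|S| ≤ η + S² / (4 η)` and the variance bound. Unlike Cauchy–Schwarz this leaves no square
root: the bound is linear in the mean, and integrates in closed form when `φ` is a kernel depending
on a further variable. -/
lemma integral_abs_average_sub_le_of_bounded {Z : Type*} [MeasurableSpace Z] (P : Measure Z)
    [IsProbabilityMeasure P] {n : ℕ} (hn : 0 < n) {φ : Z → ℝ} (hφ : Measurable φ)
    (h0 : ∀ a, 0 ≤ φ a) {C : ℝ} (hC : ∀ a, φ a ≤ C) {η : ℝ} (hη : 0 < η) :
    ∫ z, |(1 / n : ℝ) * ∑ i, φ (z i) - ∫ a, φ a ∂P| ∂(Measure.pi fun _ : Fin n => P) ≤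
      η + C / (4 * η * n) * ∫ a, φ a ∂P := by
  have hn' : (0 : ℝ) < n := by exact_mod_cast hn
  set Q : Measure (Fin n → Z) := Measure.pi fun _ => P with hQ
  set S : (Fin n → Z) → ℝ := fun z => (1 / n : ℝ) * ∑ i, φ (z i) - ∫ a, φ a ∂P with hS
  have hSm : Measurable S := by fun_prop
  have hSb : ∀ z, |S z| ≤ C + |∫ a, φ a ∂P| := fun z => by
    refine (abs_sub _ _).trans (add_le_add ?_ le_rfl)
    rw [abs_of_nonneg (mul_nonneg (by positivity) (Finset.sum_nonneg fun i _ => h0 _))]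
    calc _ ≤ (1 / n : ℝ) * ∑ i : Fin n, C := by gcongr with i; exact hC _
      _ = C := by
        simp only [Finset.sum_const, Finset.card_univ, Fintype.card_fin, nsmul_eq_mul]
        field_simp
  have hL : MemLp S 2 Q := MemLp.of_bound hSm.aestronglyMeasurable _ (Eventually.of_forall hSb)
  calc ∫ z, |S z| ∂Q ≤ ∫ z, (η + 1 / (4 * η) * S z ^ 2) ∂Q := by
        refine integral_mono (hL.integrable (by norm_num)).abs
          ((integrable_const _).add (hL.integrable_sq.const_mul _)) fun z => ?_
        have : 0 ≤ (|S z| - 2 * η) ^ 2 / (4 * η) := by positivity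
        have h2 : (|S z| - 2 * η) ^ 2 / (4 * η) = η + 1 / (4 * η) * S z ^ 2 - |S z| := by
          rw [← sq_abs (S z)]
          field_simp
          ring
        simp only
        linarith
    _ = η + 1 / (4 * η) * ∫ z, S z ^ 2 ∂Q := by
        rw [integral_add (integrable_const _) (hL.integrable_sq.const_mul _), integral_const_mul]
        simp
    _ ≤ η + 1 / (4 * η) * (C / n * ∫ a, φ a ∂P) := by
        gcongr
        exact integral_sq_average_sub_le P hn hφ h0 hC
    _ = _ := by
        congr 1
        field_simp

/-! ### The `L¹` error of an average of kernels: mean and concentration. -/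

section KernelAverage

variable {Z W : Type*} [MeasurableSpace Z] [MeasurableSpace W]

/-- Tonelli, `P` being finite. It licenses every exchange of the sample integral with the integral
over `w`. -/
lemma integrable_uncurry_of_integral_le {P : Measure Z} [IsProbabilityMeasure P] {ν : Measure W}
    [SigmaFinite ν] {k : Z → W → ℝ} (hk : Measurable (Function.uncurry k))
    (h0 : ∀ a w, 0 ≤ k a w) (hi : ∀ a, Integrable (k a) ν) {D : ℝ} (hD : ∀ a, ∫ w, k a w ∂ν ≤ D) :
    Integrable (Function.uncurry k) (P.prod ν) := by
  rw [integrable_prod_iff hk.aestronglyMeasurable]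
  refine ⟨Eventually.of_forall fun a => hi a, ?_⟩
  have hm : StronglyMeasurable fun a => ∫ w, ‖Function.uncurry k (a, w)‖ ∂ν :=
    hk.norm.stronglyMeasurable.integral_prod_right
  refine Integrable.of_bound hm.aestronglyMeasurable D (Eventually.of_forall fun a => ?_)
  rw [Real.norm_eq_abs, abs_of_nonneg (integral_nonneg fun w => norm_nonneg _)]
  refine le_trans (le_of_eq ?_) (hD a)
  congr 1 with w
  exact (Real.norm_eq_abs _).trans (abs_of_nonneg (h0 a w))

lemma integrable_uncurry_average {P : Measure Z} [IsProbabilityMeasure P] {ν : Measure W}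
    [SigmaFinite ν] {k : Z → W → ℝ} (hk : Integrable (Function.uncurry k) (P.prod ν)) (n : ℕ) :
    Integrable (fun q : (Fin n → Z) × W => (1 / n : ℝ) * ∑ i, k (q.1 i) q.2)
      ((Measure.pi fun _ => P).prod ν) := by
  refine (integrable_finsetSum _ fun i _ => ?_).const_mul _
  have mp : MeasurePreserving (Prod.map (Function.eval i) id)
      ((Measure.pi fun _ : Fin n => P).prod ν) (P.prod ν) :=
    (measurePreserving_eval (fun _ : Fin n => P) i).prod (MeasurePreserving.id ν)
  exact mp.integrable_comp_of_integrable hk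

/-- The mean `L¹` error of an average of kernels, through the truncation level `C` of the kernel,
a set `B` of finite measure and the bias `∫ |m - p|`, where `m` is the mean of the kernel. -/
lemma integral_integral_abs_average_sub_le {P : Measure Z} [IsProbabilityMeasure P]
    {ν : Measure W} [SigmaFinite ν] {k : Z → W → ℝ} (hk : Measurable (Function.uncurry k))
    (h0 : ∀ a w, 0 ≤ k a w) (hi : ∀ a, Integrable (k a) ν) (h1 : ∀ a, ∫ w, k a w ∂ν = 1)
    {p : W → ℝ} (hp : Integrable p ν) {C δ η : ℝ} (hC : 0 ≤ C) (hη : 0 < η)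
    (hδ : ∀ a, ∫ w, (k a w - min (k a w) C) ∂ν ≤ δ) {B : Set W} (hB : MeasurableSet B)
    (hBf : ν B ≠ ⊤) {n : ℕ} (hn : 0 < n) :
    ∫ z, ∫ w, |(1 / n : ℝ) * ∑ i, k (z i) w - p w| ∂ν ∂(Measure.pi fun _ : Fin n => P) ≤
      2 * δ + η * ν.real B + C / (4 * η * n) + 2 * ∫ w in Bᶜ, p w ∂ν
        + 3 * ∫ w, |∫ a, k a w ∂P - p w| ∂ν := by
  set k₁ : Z → W → ℝ := fun a w => min (k a w) C with hk₁
  set k₂ : Z → W → ℝ := fun a w => k a w - k₁ a w with hk₂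
  have hk₁m : Measurable (Function.uncurry k₁) := hk.min measurable_const
  have hk₂m : Measurable (Function.uncurry k₂) := hk.sub hk₁m
  have hk₁0 : ∀ a w, 0 ≤ k₁ a w := fun a w => le_min (h0 a w) hC
  have hk₁le : ∀ a w, k₁ a w ≤ k a w := fun a w => min_le_left _ _
  have hk₂0 : ∀ a w, 0 ≤ k₂ a w := fun a w => sub_nonneg.2 (hk₁le a w)
  have hk₂le : ∀ a w, k₂ a w ≤ k a w := fun a w => by linarith [hk₁0 a w, hk₂ ▸ le_refl (k₂ a w)]
  have hsec : ∀ {g : Z → W → ℝ}, Measurable (Function.uncurry g) → ∀ a, Measurable (g a) :=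
    fun hg a => hg.comp measurable_prodMk_left
  have hsec' : ∀ {g : Z → W → ℝ}, Measurable (Function.uncurry g) →
      ∀ w, Measurable fun a => g a w := fun hg w => hg.comp measurable_prodMk_right
  have hk₂i : ∀ a, Integrable (k₂ a) ν := fun a =>
    (hi a).mono' (hsec hk₂m a).aestronglyMeasurable (Eventually.of_forall fun w => by
      rw [Real.norm_eq_abs, abs_of_nonneg (hk₂0 a w)]; exact hk₂le a w)
  have hI : Integrable (Function.uncurry k) (P.prod ν) :=
    integrable_uncurry_of_integral_le hk h0 hi fun a => (h1 a).le
  have hI₂ : Integrable (Function.uncurry k₂) (P.prod ν) :=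
    integrable_uncurry_of_integral_le hk₂m hk₂0 hk₂i hδ
  set m : W → ℝ := fun w => ∫ a, k a w ∂P with hm
  set m₂ : W → ℝ := fun w => ∫ a, k₂ a w ∂P with hm₂
  have hmi : Integrable m ν := hI.integral_prod_right
  have hm₂i : Integrable m₂ ν := hI₂.integral_prod_right
  have hm1 : ∫ w, m w ∂ν = 1 := by
    rw [hm, ← integral_integral_swap (f := k) hI]
    simp [h1]
  have hm₂δ : ∫ w, m₂ w ∂ν ≤ δ := by
    rw [hm₂, ← integral_integral_swap (f := k₂) hI₂]
    calc _ ≤ ∫ _ : Z, δ ∂P := integral_mono hI₂.integral_prod_left (integrable_const _) hδ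
      _ = δ := by simp
  set Q : Measure (Fin n → Z) := Measure.pi fun _ => P with hQ
  have hA := integrable_uncurry_average (n := n) hI
  have hE : Integrable (Function.uncurry fun (z : Fin n → Z) w =>
      |(1 / n : ℝ) * ∑ i, k (z i) w - p w|) (Q.prod ν) := (hA.sub (hp.comp_snd Q)).abs
  -- After the exchange the mean deviation is bounded separately at almost every `w`.
  rw [integral_integral_swap hE]
  have hmp : Integrable (fun w => |m w - p w|) ν := (hmi.sub hp).abs
  have hBη : Integrable (B.indicator fun _ => η) ν :=
    (integrable_indicator_iff hB).2 (integrableOn_const hBf)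
  have hBp : Integrable (Bᶜ.indicator fun w => 2 * p w) ν := (hp.const_mul 2).indicator hB.compl
  have hs₂ : Integrable (fun w => B.indicator (fun _ => η) w + C / (4 * η * n) * m w) ν :=
    hBη.add (hmi.const_mul _)
  have hs₃ : Integrable (fun w => B.indicator (fun _ => η) w + C / (4 * η * n) * m w
      + 2 * m₂ w) ν := hs₂.add (hm₂i.const_mul _)
  have hs₄ : Integrable (fun w => B.indicator (fun _ => η) w + C / (4 * η * n) * m w
      + 2 * m₂ w + Bᶜ.indicator (fun w => 2 * p w) w) ν := hs₃.add hBp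
  have hfin : Integrable (fun w => B.indicator (fun _ => η) w + C / (4 * η * n) * m w + 2 * m₂ w
      + Bᶜ.indicator (fun w => 2 * p w) w + 3 * |m w - p w|) ν := hs₄.add (hmp.const_mul _)
  calc _ ≤ ∫ w, (B.indicator (fun _ => η) w + C / (4 * η * n) * m w + 2 * m₂ w
      + Bᶜ.indicator (fun w => 2 * p w) w + 3 * |m w - p w|) ∂ν := by
        refine integral_mono_ae hE.integral_prod_right hfin ?_
        filter_upwards [hI.prod_left_ae] with w hw
        have hw' : Integrable (fun a => k a w) P := hw
        have hw₁ : Integrable (fun a => k₁ a w) P :=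
          hw'.mono' (hsec' hk₁m w).aestronglyMeasurable (Eventually.of_forall fun a => by
            rw [Real.norm_eq_abs, abs_of_nonneg (hk₁0 a w)]; exact hk₁le a w)
        have hw₂ : Integrable (fun a => k₂ a w) P := hw'.sub hw₁
        have hm0 : 0 ≤ m w := integral_nonneg fun a => h0 a w
        have hm₂0 : 0 ≤ m₂ w := integral_nonneg fun a => hk₂0 a w
        have hav : ∀ {φ : Z → ℝ}, Integrable φ P →
            Integrable (fun z : Fin n → Z => (1 / n : ℝ) * ∑ i, φ (z i)) Q := fun hφ =>
          (integrable_finsetSum _ fun i _ => integrable_comp_eval_pi P hφ i).const_mul _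
        have hdev : ∀ {φ : Z → ℝ}, Integrable φ P → ∀ b : ℝ,
            Integrable (fun z : Fin n → Z => |(1 / n : ℝ) * ∑ i, φ (z i) - b|) Q := fun hφ b =>
          ((hav hφ).sub (integrable_const b)).abs
        have htri : ∫ z, |(1 / n : ℝ) * ∑ i, k (z i) w - p w| ∂Q ≤
            ∫ z, |(1 / n : ℝ) * ∑ i, k (z i) w - m w| ∂Q + |m w - p w| := by
          calc _ ≤ ∫ z, (|(1 / n : ℝ) * ∑ i, k (z i) w - m w| + |m w - p w|) ∂Q :=
                integral_mono (hdev hw' _)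
                  ((hdev hw' _).add (integrable_const _))
                  fun z => abs_sub_le _ _ _
            _ = _ := by
                rw [integral_add (hdev hw' _) (integrable_const _)]
                simp
        have hcoef : 0 ≤ C / (4 * η * n) := by positivity
        -- On `B` the truncated part is bounded through its variance and the remainder by twice its
        -- mean `m₂`. Off `B`, where the constant `η` would not be integrable in general, the
        -- first-moment bound `2 m ≤ 2 p + 2 |m - p|` is used; with the bias already split off this
        -- gives the coefficient 3.
        by_cases hwB : w ∈ B
        · have hmsum : m w = (∫ a, k₁ a w ∂P) + m₂ w := by
            rw [hm, hm₂, ← integral_add hw₁ hw₂]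
            simp [hk₂]
          have hsplit : ∫ z, |(1 / n : ℝ) * ∑ i, k (z i) w - m w| ∂Q ≤
              ∫ z, |(1 / n : ℝ) * ∑ i, k₁ (z i) w - ∫ a, k₁ a w ∂P| ∂Q
              + ∫ z, |(1 / n : ℝ) * ∑ i, k₂ (z i) w - m₂ w| ∂Q := by
            rw [← integral_add (hdev hw₁ _)
              (hdev hw₂ _)]
            refine integral_mono (hdev hw' _)
              ((hdev hw₁ _).add
                (hdev hw₂ _)) fun z => ?_
            refine le_trans (le_of_eq ?_) (abs_add_le _ _)
            rw [hmsum]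
            congr 1
            simp only [hk₂, Finset.sum_sub_distrib]
            ring
          have hb := integral_abs_average_sub_le_of_bounded P hn (hsec' hk₁m w)
            (fun a => hk₁0 a w) (fun a => min_le_right (k a w) C) hη
          have hc := integral_abs_average_sub_le_two_mul P hn hw₂ (fun a => hk₂0 a w)
          have hle : C / (4 * η * n) * ∫ a, k₁ a w ∂P ≤ C / (4 * η * n) * m w :=
            mul_le_mul_of_nonneg_left (by linarith) hcoef
          have hnB : w ∉ Bᶜ := fun h => h hwB
          rw [Set.indicator_of_mem hwB, Set.indicator_of_notMem hnB]
          have := abs_nonneg (m w - p w)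
          linarith
        · have hc := integral_abs_average_sub_le_two_mul P hn hw' (fun a => h0 a w)
          rw [Set.indicator_of_notMem hwB, Set.indicator_of_mem (show w ∈ Bᶜ from hwB)]
          have h2 := le_abs_self (m w - p w)
          have h3 := mul_nonneg hcoef hm0
          linarith
    _ = ν.real B * η + C / (4 * η * n) * 1 + 2 * (∫ w, m₂ w ∂ν) + (∫ w in Bᶜ, 2 * p w ∂ν)
        + 3 * ∫ w, |m w - p w| ∂ν := by
        rw [integral_add hs₄ (hmp.const_mul _), integral_add hs₃ hBp,
          integral_add hs₂ (hm₂i.const_mul _), integral_add hBη (hmi.const_mul _),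
          integral_indicator hB, integral_indicator hB.compl,
          integral_const_mul, integral_const_mul, integral_const_mul, integral_const_mul, hm1]
        simp
    _ ≤ _ := by
        rw [integral_const_mul]
        linarith

/-- McDiarmid's inequality for the `L¹` error of an average of kernels of mass one. -/
lemma measureReal_integral_abs_average_sub_le {P : Measure Z} [IsProbabilityMeasure P]
    {ν : Measure W} [SigmaFinite ν] {k : Z → W → ℝ} (hk : Measurable (Function.uncurry k))
    (h0 : ∀ a w, 0 ≤ k a w) (hi : ∀ a, Integrable (k a) ν) (h1 : ∀ a, ∫ w, k a w ∂ν = 1)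
    {p : W → ℝ} (hpm : Measurable p) (hp : Integrable p ν) {n : ℕ} (hn : 0 < n) {t : ℝ}
    (ht : 0 ≤ t) (hmean : ∫ z, ∫ w, |(1 / n : ℝ) * ∑ i, k (z i) w - p w| ∂ν
      ∂(Measure.pi fun _ : Fin n => P) ≤ t) :
    (Measure.pi fun _ : Fin n => P).real
        {z | 2 * t ≤ ∫ w, |(1 / n : ℝ) * ∑ i, k (z i) w - p w| ∂ν} ≤
      Real.exp (-(n * t ^ 2 / 2)) := by
  have hn' : (0 : ℝ) < n := by exact_mod_cast hn
  set F : (Fin n → Z) → ℝ := fun z => ∫ w, |(1 / n : ℝ) * ∑ i, k (z i) w - p w| ∂ν with hF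
  have hav : ∀ z : Fin n → Z, Integrable (fun w => (1 / n : ℝ) * ∑ i, k (z i) w) ν := fun z =>
    (integrable_finsetSum _ fun i _ => hi _).const_mul _
  have hmeas : Measurable fun q : (Fin n → Z) × W =>
      |(1 / n : ℝ) * ∑ i, k (q.1 i) q.2 - p q.2| := by
    refine (Measurable.sub ?_ (hpm.comp measurable_snd)).abs
    refine (Finset.measurable_sum _ fun i _ => ?_).const_mul _
    have hq : Measurable fun q : (Fin n → Z) × W => (q.1 i, q.2) := by fun_prop
    exact hk.comp hq
  have hFm : Measurable F := hmeas.stronglyMeasurable.integral_prod_right.measurable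
  have hdev : ∀ z : Fin n → Z, Integrable (fun w => |(1 / n : ℝ) * ∑ i, k (z i) w - p w|) ν :=
    fun z => ((hav z).sub hp).abs
  have hFC : ∀ z, |F z| ≤ 1 + ∫ w, |p w| ∂ν := by
    intro z
    rw [abs_of_nonneg (integral_nonneg fun w => abs_nonneg _)]
    calc F z ≤ ∫ w, ((1 / n : ℝ) * ∑ i, k (z i) w + |p w|) ∂ν := by
          refine integral_mono (hdev z) ((hav z).add hp.abs) fun w => ?_
          refine (abs_sub _ _).trans (le_of_eq ?_)
          rw [abs_of_nonneg (mul_nonneg (by positivity) (Finset.sum_nonneg fun i _ => h0 _ _))]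
      _ = _ := by
          rw [integral_add (hav z) hp.abs, integral_const_mul,
            integral_finsetSum _ fun i _ => hi _]
          simp only [h1, Finset.sum_const, Finset.card_univ, Fintype.card_fin, nsmul_eq_mul]
          field_simp
  -- A one-sided bound, symmetric in `z` and `z'`, gives the absolute value. Only the `i`-th kernels
  -- differ, and each has mass one.
  have hlip : ∀ z z' : Fin n → Z, ∀ i, (∀ j, j ≠ i → z j = z' j) → F z - F z' ≤ 2 / n := by
    intro z z' i hj
    rw [hF]
    dsimp only
    rw [← integral_sub (hdev z) (hdev z')]
    calc _ ≤ ∫ w, (1 / n : ℝ) * (k (z i) w + k (z' i) w) ∂ν := by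
          refine integral_mono ((hdev z).sub (hdev z'))
            (((hi _).add (hi _)).const_mul _) fun w => ?_
          refine (abs_sub_abs_le_abs_sub _ _).trans ?_
          have : (1 / n : ℝ) * ∑ i, k (z i) w - p w - ((1 / n : ℝ) * ∑ i, k (z' i) w - p w) =
              (1 / n : ℝ) * (k (z i) w - k (z' i) w) := by
            rw [sub_sub_sub_cancel_right, ← mul_sub, ← Finset.sum_sub_distrib,
              Finset.sum_eq_single i (fun j _ hji => by rw [hj j hji, sub_self]) (by simp)]
          rw [this, abs_mul, abs_of_nonneg (by positivity : (0 : ℝ) ≤ 1 / n)]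
          gcongr
          refine (abs_sub _ _).trans (le_of_eq ?_)
          rw [abs_of_nonneg (h0 _ _), abs_of_nonneg (h0 _ _)]
      _ = _ := by
          rw [integral_const_mul, integral_add (hi _) (hi _), h1, h1]
          ring
  have hbd := measureReal_le_of_boundedDifferences P hn F hFm hFC (fun z i v => by
    refine abs_sub_le_iff.2 ⟨hlip _ _ i fun j hj => ?_, hlip _ _ i fun j hj => ?_⟩ <;>
    simp [hj]) ht
  -- As the mean is at most `t`, exceeding `2 t` means exceeding the mean by at least `t`.
  refine le_trans (measureReal_mono ?_) hbd
  intro z hz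
  simp only [Set.mem_ofPred_eq] at hz ⊢
  linarith

end KernelAverage

/-! ### Translations, rescaling and smoothing in `L¹`. -/

section Translation

variable {d : ℕ}

/-- Translations act continuously on `L¹`. -/
lemma tendsto_integral_abs_translate_sub {g : EuclideanSpace ℝ (Fin d) → ℝ} (hg : Integrable g) :
    Tendsto (fun v => ∫ x, |g (v + x) - g x|) (𝓝 0) (𝓝 0) := by
  have : Fact ((1 : ENNReal) ≠ ⊤) := ⟨ENNReal.one_ne_top⟩
  have hL : MemLp g 1 volume := memLp_one_iff_integrable.2 hg
  have hcont : Continuous fun v : EuclideanSpace ℝ (Fin d) => DomAddAct.mk v +ᵥ hL.toLp g := by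
    have : Continuous fun c : (EuclideanSpace ℝ (Fin d))ᵈᵃᵃ => c +ᵥ hL.toLp g :=
      continuous_id.vadd continuous_const
    exact this.comp DomAddAct.continuous_mk
  have h0 : Tendsto (fun v => ‖(DomAddAct.mk v +ᵥ hL.toLp g) - hL.toLp g‖)
      (𝓝 (0 : EuclideanSpace ℝ (Fin d))) (𝓝 0) := by
    have := ((hcont.sub continuous_const).norm :
      Continuous fun v => ‖(DomAddAct.mk v +ᵥ hL.toLp g) - hL.toLp g‖).tendsto 0
    simpa using this
  refine h0.congr fun v => ?_
  rw [DomAddAct.mk_vadd_toLp, ← MemLp.toLp_sub, L1.norm_eq_integral_norm]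
  refine integral_congr_ae ?_
  filter_upwards [MemLp.coeFn_toLp ((hL.comp_measurePreserving
    (measurePreserving_vadd v volume)).sub hL)] with x hx
  exact congrArg norm hx

lemma integral_abs_translate_sub_le {g : EuclideanSpace ℝ (Fin d) → ℝ} (hg : Integrable g)
    (v : EuclideanSpace ℝ (Fin d)) : ∫ x, |g (v + x) - g x| ≤ 2 * ∫ x, |g x| := by
  have hv : Integrable fun x => g (v + x) := hg.comp_add_left v
  calc _ ≤ ∫ x, (|g (v + x)| + |g x|) :=
        integral_mono (hv.sub hg).abs (hv.abs.add hg.abs) fun x => abs_sub _ _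
    _ = _ := by
        rw [integral_add hv.abs hg.abs, integral_add_left_eq_self (fun x => |g x|) v]
        ring

/-- Smoothing by a rescaled kernel converges in `L¹` as the bandwidth tends to `0`. -/
lemma tendsto_integral_abs_smoothing_sub {g K : EuclideanSpace ℝ (Fin d) → ℝ}
    (hgm : Measurable g) (hg : Integrable g) (hKm : Measurable K) (hK0 : ∀ u, 0 ≤ K u)
    (hK1 : ∫ u, K u = 1) {h : ℕ → ℝ} (hh : Tendsto h atTop (𝓝 0)) :
    Tendsto (fun n => ∫ x, |(∫ u, K u * g (h n • u + x)) - g x|) atTop (𝓝 0) := by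
  have hKi : Integrable K := Integrable.of_integral_ne_zero (by rw [hK1]; norm_num)
  -- This `K`-average of translation errors dominates the smoothing error. It vanishes by dominated
  -- convergence, with dominating function `2 ‖g‖₁ K`.
  have hT : Tendsto (fun n => ∫ u, K u * ∫ x, |g (h n • u + x) - g x|) atTop (𝓝 0) := by
    have : (0 : ℝ) = ∫ u : EuclideanSpace ℝ (Fin d), K u * 0 := by simp
    rw [this]
    refine tendsto_integral_of_dominated_convergence (fun u => K u * (2 * ∫ x, |g x|))
      (fun n => ?_) (hKi.mul_const _) (fun n => Eventually.of_forall fun u => ?_)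
      (Eventually.of_forall fun u => ?_)
    · have hm : Measurable fun q : EuclideanSpace ℝ (Fin d) × EuclideanSpace ℝ (Fin d) =>
          |g (h n • q.1 + q.2) - g q.2| := by fun_prop
      exact hKm.aestronglyMeasurable.mul
        hm.stronglyMeasurable.integral_prod_right.aestronglyMeasurable
    · rw [Real.norm_eq_abs, abs_of_nonneg (mul_nonneg (hK0 u)
        (integral_nonneg fun x => abs_nonneg _))]
      exact mul_le_mul_of_nonneg_left (integral_abs_translate_sub_le hg _) (hK0 u)
    · refine Tendsto.const_mul _ ((tendsto_integral_abs_translate_sub hg).comp ?_)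
      simpa using hh.smul_const u
  refine squeeze_zero (fun n => integral_nonneg fun x => abs_nonneg _) (fun n => ?_) hT
  have hsh : ∀ v, Integrable fun x => g (v + x) := fun v => hg.comp_add_left v
  have hjm : Measurable fun q : EuclideanSpace ℝ (Fin d) × EuclideanSpace ℝ (Fin d) =>
      K q.1 * (g (h n • q.1 + q.2) - g q.2) := by fun_prop
  have hj : Integrable (Function.uncurry fun u x => K u * (g (h n • u + x) - g x))
      (volume.prod volume) := by
    refine (integrable_prod_iff hjm.aestronglyMeasurable).2
      ⟨Eventually.of_forall fun u => ((hsh (h n • u)).sub hg).const_mul (K u), ?_⟩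
    refine (hKi.mul_const (2 * ∫ x, |g x|)).mono'
      hjm.norm.stronglyMeasurable.integral_prod_right.aestronglyMeasurable
      (Eventually.of_forall fun u => ?_)
    rw [Real.norm_eq_abs, abs_of_nonneg (integral_nonneg fun x => norm_nonneg _)]
    simp only [norm_mul, Real.norm_eq_abs, abs_of_nonneg (hK0 u),
      integral_const_mul]
    exact mul_le_mul_of_nonneg_left (integral_abs_translate_sub_le hg _) (hK0 u)
  have hja : Integrable (Function.uncurry fun u x => K u * |g (h n • u + x) - g x|)
      (volume.prod volume) := by
    refine hj.abs.congr (Eventually.of_forall fun q => ?_)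
    simp only [Function.uncurry, abs_mul, abs_of_nonneg (hK0 q.1)]
  have hswap := integral_integral_swap hja
  simp only [integral_const_mul] at hswap
  rw [hswap]
  refine integral_mono_of_nonneg (Eventually.of_forall fun x => abs_nonneg _)
    hja.integral_prod_right ?_
  filter_upwards [hj.prod_left_ae] with x hx
  have hx' : Integrable fun u => K u * (g (h n • u + x) - g x) := hx
  have hKg : Integrable fun u => K u * g x := hKi.mul_const _
  -- As `K` has mass one, `g x` can be taken under the integral.
  have heq : (∫ u, K u * g (h n • u + x)) - g x = ∫ u, K u * (g (h n • u + x) - g x) := by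
    have h1 : (∫ u, K u * g (h n • u + x)) =
        ∫ u, (K u * (g (h n • u + x) - g x) + K u * g x) := by
      congr 1 with u
      ring
    rw [h1, integral_add hx' hKg, integral_mul_const, hK1]
    ring
  rw [heq]
  refine (abs_integral_le_integral_abs).trans (le_of_eq ?_)
  congr 1 with u
  rw [abs_mul, abs_of_nonneg (hK0 u)]

lemma integrable_rescaled {K : EuclideanSpace ℝ (Fin d) → ℝ} (hK : Integrable K) {h : ℝ}
    (hh : 0 < h) (a : EuclideanSpace ℝ (Fin d)) :
    Integrable fun x => (1 / h ^ d) * K (h⁻¹ • (a - x)) :=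
  (((integrable_comp_smul_iff volume K (inv_ne_zero hh.ne')).2 hK).comp_sub_left a).const_mul _

lemma integral_rescaled (K : EuclideanSpace ℝ (Fin d) → ℝ) {h : ℝ} (hh : 0 < h)
    (a : EuclideanSpace ℝ (Fin d)) :
    ∫ x, (1 / h ^ d) * K (h⁻¹ • (a - x)) = ∫ u, K u := by
  have hd : (0 : ℝ) < h ^ d := pow_pos hh d
  rw [integral_const_mul, integral_sub_left_eq_self (fun x => K (h⁻¹ • x)) volume a,
    Measure.integral_comp_inv_smul]
  simp only [finrank_euclideanSpace, Fintype.card_fin, abs_of_pos hd, smul_eq_mul]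
  field_simp

/-- The substitution `a = h u + x`. It turns the mean of the estimator into a `K`-average of
translates of the density. -/
lemma integral_mul_rescaled (g K : EuclideanSpace ℝ (Fin d) → ℝ) {h : ℝ} (hh : 0 < h)
    (x : EuclideanSpace ℝ (Fin d)) :
    ∫ a, g a * ((1 / h ^ d) * K (h⁻¹ • (a - x))) = ∫ u, K u * g (h • u + x) := by
  have hd : (0 : ℝ) < h ^ d := pow_pos hh d
  have h1 := integral_sub_right_eq_self (μ := (volume : Measure (EuclideanSpace ℝ (Fin d))))
    (fun b => g (b + x) * ((1 / h ^ d) * K (h⁻¹ • b))) x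
  simp only [sub_add_cancel] at h1
  have h2 := Measure.integral_comp_inv_smul (volume : Measure (EuclideanSpace ℝ (Fin d)))
    (fun u => K u * g (h • u + x)) h
  simp only [smul_inv_smul₀ hh.ne', finrank_euclideanSpace, Fintype.card_fin, abs_of_pos hd,
    smul_eq_mul] at h2
  rw [h1, eq_comm, ← mul_right_inj' hd.ne', ← h2, ← integral_const_mul]
  congr 1 with b
  field_simp

/-- Truncating an integrable function at a high level changes its integral little. -/
lemma exists_integral_sub_min_le {K : EuclideanSpace ℝ (Fin d) → ℝ} (hK : Integrable K)
    (hK0 : ∀ u, 0 ≤ K u) {δ : ℝ} (hδ : 0 < δ) :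
    ∃ M : ℝ, 0 ≤ M ∧ ∫ u, (K u - min (K u) M) ≤ δ := by
  have hT : Tendsto (fun M : ℕ => ∫ u, (K u - min (K u) M)) atTop (𝓝 0) := by
    have : (0 : ℝ) = ∫ _ : EuclideanSpace ℝ (Fin d), (0 : ℝ) := by simp
    rw [this]
    refine tendsto_integral_of_dominated_convergence K
      (fun M => hK.1.sub (hK.1.inf aestronglyMeasurable_const)) hK
      (fun M => Eventually.of_forall fun u => ?_) (Eventually.of_forall fun u => ?_)
    · have h1 : 0 ≤ min (K u) (M : ℝ) := le_min (hK0 u) (Nat.cast_nonneg M)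
      rw [Real.norm_eq_abs, abs_of_nonneg (sub_nonneg.2 (min_le_left _ _))]
      linarith
    · obtain ⟨N, hN⟩ := exists_nat_ge (K u)
      refine tendsto_const_nhds.congr' ?_
      filter_upwards [eventually_ge_atTop N] with M hM
      rw [min_eq_left (hN.trans (by exact_mod_cast hM)), sub_self]
  obtain ⟨M, hM⟩ := (hT.eventually (ge_mem_nhds hδ)).exists
  exact ⟨M, Nat.cast_nonneg M, hM⟩

end Translation

/-! ### Integration against Lebesgue times counting measure, and the joint density. -/

lemma exists_setIntegral_compl_le {W : Type*} [MeasurableSpace W] {ν : Measure W} [SigmaFinite ν]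
    {p : W → ℝ} (hp : Integrable p ν) {δ : ℝ} (hδ : 0 < δ) :
    ∃ B, MeasurableSet B ∧ ν B ≠ ⊤ ∧ ∫ w in Bᶜ, p w ∂ν ≤ δ := by
  have hT := tendsto_setIntegral_of_antitone (μ := ν) (f := p)
    (s := fun i => (spanningSets ν i)ᶜ) (fun i => (measurableSet_spanningSets ν i).compl)
    (fun i j hij => Set.compl_subset_compl.2 (monotone_spanningSets ν hij)) ⟨0, hp.integrableOn⟩
  rw [← Set.compl_iUnion, iUnion_spanningSets, Set.compl_univ, setIntegral_empty] at hT
  obtain ⟨i, hi⟩ := (hT.eventually (ge_mem_nhds hδ)).exists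
  exact ⟨_, measurableSet_spanningSets ν i, (measure_spanningSets_lt_top ν i).ne, hi⟩

section ProdCount

variable {α 𝒴 : Type*} [MeasurableSpace α] [Fintype 𝒴] [MeasurableSpace 𝒴]

lemma integrable_section_of_prod_count {μ : Measure α} [SigmaFinite μ] {f : α × 𝒴 → ℝ}
    (hf : Integrable f (μ.prod Measure.count)) (y : 𝒴) : Integrable (fun x => f (x, y)) μ := by
  have := hf.prod_left_ae
  
  exact Measure.ae_count_iff.1 this y

variable [MeasurableSingletonClass 𝒴]

lemma integral_prod_count {μ : Measure α} [SigmaFinite μ] {f : α × 𝒴 → ℝ}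
    (hf : Integrable f (μ.prod Measure.count)) :
    ∫ w, f w ∂(μ.prod Measure.count) = ∑ y, ∫ x, f (x, y) ∂μ := by
  rw [integral_prod_symm _ hf, integral_count]

lemma integrable_prod_count {μ : Measure α} [SigmaFinite μ] {f : α × 𝒴 → ℝ}
    (hf : AEStronglyMeasurable f (μ.prod Measure.count))
    (hi : ∀ y, Integrable (fun x => f (x, y)) μ) : Integrable f (μ.prod Measure.count) := by
  rw [integrable_prod_iff' hf]
  exact ⟨Eventually.of_forall hi, Integrable.of_finite⟩

end ProdCount

section JointDensity

variable {d : ℕ} {𝒴 : Type*} [MeasurableSpace 𝒴]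
  {P : Measure (EuclideanSpace ℝ (Fin d) × 𝒴)}

/-- A null set for the product has null sections, and it is covered by the finitely many cylinders
over them, each `P`-null by the hypothesis on the `x`-marginal. -/
lemma absolutelyContinuous_prod_count [Fintype 𝒴] [MeasurableSingletonClass 𝒴]
    (hac : P.map Prod.fst ≪ (volume : Measure (EuclideanSpace ℝ (Fin d)))) :
    P ≪ (volume : Measure (EuclideanSpace ℝ (Fin d))).prod Measure.count := by
  refine Measure.AbsolutelyContinuous.mk fun s hs h0 => ?_
  have hsec : ∀ y : 𝒴, volume ((fun x => (x, y)) ⁻¹' s) = 0 := by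
    rw [Measure.prod_apply_symm hs, lintegral_count, ENNReal.tsum_eq_zero] at h0
    exact h0
  have hsub : s ⊆ ⋃ y : 𝒴, Prod.fst ⁻¹' ((fun x => (x, y)) ⁻¹' s) := by
    rintro ⟨x, y⟩ hxy
    exact Set.mem_iUnion.2 ⟨y, hxy⟩
  refine measure_mono_null hsub (measure_iUnion_null fun y => ?_)
  rw [← Measure.map_apply measurable_fst (hs.preimage measurable_prodMk_right)]
  exact hac (hsec y)

lemma measurable_jointDensity :
    Measurable fun w : EuclideanSpace ℝ (Fin d) × 𝒴 => jointDensity P w.1 w.2 :=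
  (Measure.measurable_rnDeriv _ _).ennreal_toReal

lemma integrable_jointDensity [IsFiniteMeasure P] :
    Integrable (fun w : EuclideanSpace ℝ (Fin d) × 𝒴 => jointDensity P w.1 w.2)
      (volume.prod Measure.count) :=
  Measure.integrable_toReal_rnDeriv

end JointDensity

/-! ### The kernel estimator: its bias and mean error. -/

section SmoothingKernel

variable {d : ℕ} {𝒴 : Type*}

open Classical in
/-- The contribution of a sample point `z` to the kernel-smoothed joint estimator at `w`. -/
noncomputable def jointKernel (K : EuclideanSpace ℝ (Fin d) → ℝ) (h : ℝ)
    (z w : EuclideanSpace ℝ (Fin d) × 𝒴) : ℝ :=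
  (if z.2 = w.2 then (1 : ℝ) else 0) * ((1 / h ^ d) * K (h⁻¹ • (z.1 - w.1)))

lemma kde_eq_average (K : EuclideanSpace ℝ (Fin d) → ℝ) (h : ℝ) (n : ℕ)
    (xs : ℕ → EuclideanSpace ℝ (Fin d)) (ys : ℕ → 𝒴) (w : EuclideanSpace ℝ (Fin d) × 𝒴) :
    kde K h n xs ys w.1 w.2 =
      (1 / n : ℝ) * ∑ i : Fin n, jointKernel K h (xs i, ys i) w := by
  rw [kde, Finset.sum_range]
  rfl

lemma jointKernel_nonneg {K : EuclideanSpace ℝ (Fin d) → ℝ} (hK0 : ∀ u, 0 ≤ K u) {h : ℝ}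
    (hh : 0 < h) (z w : EuclideanSpace ℝ (Fin d) × 𝒴) : 0 ≤ jointKernel K h z w := by
  unfold jointKernel
  have := hK0 (h⁻¹ • (z.1 - w.1))
  split_ifs <;> positivity

/-- Truncation at `M / h ^ d` commutes with rescaling. The mass cut off therefore does not depend on
`h`, and one level `M` serves all bandwidths. -/
lemma jointKernel_sub_min {K : EuclideanSpace ℝ (Fin d) → ℝ} {M : ℝ} (hM : 0 ≤ M) {h : ℝ}
    (hh : 0 < h) (z w : EuclideanSpace ℝ (Fin d) × 𝒴) :
    jointKernel K h z w - min (jointKernel K h z w) (M / h ^ d) =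
      jointKernel (fun u => K u - min (K u) M) h z w := by
  have hd : 0 < h ^ d := pow_pos hh d
  unfold jointKernel
  split_ifs
  · have : M / h ^ d = 1 / h ^ d * M := by ring
    rw [one_mul, one_mul, this, ← mul_min_of_nonneg _ _ (by positivity), mul_sub]
  · rw [zero_mul, zero_mul, min_eq_left (by positivity), sub_zero]

variable [Fintype 𝒴] [MeasurableSpace 𝒴] [MeasurableSingletonClass 𝒴]

lemma measurable_jointKernel {K : EuclideanSpace ℝ (Fin d) → ℝ} (hKm : Measurable K) (h : ℝ) :
    Measurable (Function.uncurry (jointKernel (𝒴 := 𝒴) K h)) := by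
  refine Measurable.mul ?_ (by fun_prop)
  refine Measurable.ite ?_ measurable_const measurable_const
  exact measurableSet_eq_fun (by fun_prop) (by fun_prop)

lemma integrable_jointKernel {K : EuclideanSpace ℝ (Fin d) → ℝ} (hKm : Measurable K)
    (hK : Integrable K) {h : ℝ} (hh : 0 < h) (z : EuclideanSpace ℝ (Fin d) × 𝒴) :
    Integrable (jointKernel K h z) (volume.prod Measure.count) :=
  integrable_prod_count
    ((measurable_jointKernel hKm h).comp measurable_prodMk_left).aestronglyMeasurable
    fun y => by
      by_cases hy : z.2 = y
      · simpa [jointKernel, hy] using integrable_rescaled hK hh z.1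
      · simp [jointKernel, hy]

lemma integral_jointKernel {K : EuclideanSpace ℝ (Fin d) → ℝ} (hKm : Measurable K)
    (hK : Integrable K) {h : ℝ} (hh : 0 < h) (z : EuclideanSpace ℝ (Fin d) × 𝒴) :
    ∫ w, jointKernel K h z w ∂(volume.prod Measure.count) = ∫ u, K u := by
  classical
  rw [integral_prod_count (integrable_jointKernel hKm hK hh z)]
  rw [Finset.sum_eq_single z.2]
  · simp only [jointKernel, if_true, one_mul]
    exact integral_rescaled K hh z.1
  · intro y _ hy
    simp [jointKernel, Ne.symm hy]
  · simp

/-- The mean of the estimator is the smoothed density. -/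
lemma integral_jointKernel_left_ae {P : Measure (EuclideanSpace ℝ (Fin d) × 𝒴)}
    [IsProbabilityMeasure P] (hac : P.map Prod.fst ≪ (volume : Measure (EuclideanSpace ℝ (Fin d))))
    {K : EuclideanSpace ℝ (Fin d) → ℝ} (hKm : Measurable K) (hK0 : ∀ u, 0 ≤ K u)
    (hK : Integrable K) {h : ℝ} (hh : 0 < h) :
    ∀ᵐ w ∂((volume : Measure (EuclideanSpace ℝ (Fin d))).prod (Measure.count (α := 𝒴))),
      ∫ z, jointKernel K h z w ∂P = ∫ u, K u * jointDensity P (h • u + w.1) w.2 := by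
  classical
  have hPν := absolutelyContinuous_prod_count hac
  have hI : Integrable (Function.uncurry (jointKernel (𝒴 := 𝒴) K h))
      (P.prod (volume.prod Measure.count)) :=
    integrable_uncurry_of_integral_le (measurable_jointKernel hKm h)
      (fun z w => jointKernel_nonneg hK0 hh z w) (fun z => integrable_jointKernel hKm hK hh z)
      fun z => (integral_jointKernel hKm hK hh z).le
  filter_upwards [hI.prod_left_ae] with w hw
  have hw' : Integrable (fun z => jointKernel K h z w) P := hw
  rw [← integral_rnDeriv_smul hPν]
  have hi := (integrable_rnDeriv_smul_iff hPν).2 hw'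
  rw [integral_prod_count hi, Finset.sum_eq_single w.2]
  · rw [← integral_mul_rescaled (fun a => jointDensity P a w.2) K hh w.1]
    congr 1 with a
    simp [jointKernel, jointDensity]
  · intro y _ hy
    simp [jointKernel, hy]
  · simp

/-- The bias of the estimator vanishes in `L¹`. -/
lemma tendsto_bias {P : Measure (EuclideanSpace ℝ (Fin d) × 𝒴)}
    [IsProbabilityMeasure P] (hac : P.map Prod.fst ≪ (volume : Measure (EuclideanSpace ℝ (Fin d))))
    {K : EuclideanSpace ℝ (Fin d) → ℝ} (hKm : Measurable K) (hK0 : ∀ u, 0 ≤ K u)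
    (hK1 : ∫ u, K u = 1) {h : ℕ → ℝ} (hh : ∀ n, 0 < h n) (hh0 : Tendsto h atTop (𝓝 0)) :
    Tendsto (fun n => ∫ w, |∫ z, jointKernel K (h n) z w ∂P - jointDensity P w.1 w.2|
      ∂(volume.prod Measure.count)) atTop (𝓝 0) := by
  have hK : Integrable K := Integrable.of_integral_ne_zero (by rw [hK1]; norm_num)
  have hp := integrable_jointDensity (P := P)
  have heq : ∀ n, ∫ w, |∫ z, jointKernel K (h n) z w ∂P - jointDensity P w.1 w.2|
      ∂(volume.prod Measure.count) =
      ∑ y, ∫ x, |(∫ u, K u * jointDensity P (h n • u + x) y) - jointDensity P x y| := by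
    intro n
    have hI : Integrable (Function.uncurry (jointKernel (𝒴 := 𝒴) K (h n)))
        (P.prod (volume.prod Measure.count)) :=
      integrable_uncurry_of_integral_le (measurable_jointKernel hKm (h n))
        (fun z w => jointKernel_nonneg hK0 (hh n) z w)
        (fun z => integrable_jointKernel hKm hK (hh n) z)
        fun z => (integral_jointKernel hKm hK (hh n) z).le
    have hm : Integrable (fun w => |∫ z, jointKernel K (h n) z w ∂P - jointDensity P w.1 w.2|)
        (volume.prod Measure.count) := (hI.integral_prod_right.sub hp).abs
    have hae := integral_jointKernel_left_ae hac hKm hK0 hK (hh n)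
    have hae' : (fun w => |∫ z, jointKernel K (h n) z w ∂P - jointDensity P w.1 w.2|)
        =ᵐ[volume.prod Measure.count] fun w =>
        |(∫ u, K u * jointDensity P (h n • u + w.1) w.2) - jointDensity P w.1 w.2| := by
      filter_upwards [hae] with w hw
      rw [hw]
    rw [integral_congr_ae hae', integral_prod_count (hm.congr hae')]
  simp_rw [heq]
  have : (0 : ℝ) = ∑ _ : 𝒴, (0 : ℝ) := by simp
  rw [this]
  refine tendsto_finsetSum _ fun y _ => ?_
  exact tendsto_integral_abs_smoothing_sub
    (measurable_jointDensity.comp measurable_prodMk_right)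
    (integrable_section_of_prod_count hp y) hKm hK0 hK1 hh0

/-- The mean `L¹` error of the kernel-smoothed joint estimator vanishes. -/
lemma eventually_integral_error_le {P : Measure (EuclideanSpace ℝ (Fin d) × 𝒴)}
    [IsProbabilityMeasure P] (hac : P.map Prod.fst ≪ (volume : Measure (EuclideanSpace ℝ (Fin d))))
    {K : EuclideanSpace ℝ (Fin d) → ℝ} (hKm : Measurable K) (hK0 : ∀ u, 0 ≤ K u)
    (hK1 : ∫ u, K u = 1) {h : ℕ → ℝ} (hh : ∀ n, 0 < h n) (hh0 : Tendsto h atTop (𝓝 0))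
    (hnh : Tendsto (fun n : ℕ => (n : ℝ) * h n ^ d) atTop atTop) {t : ℝ} (ht : 0 < t) :
    ∀ᶠ n : ℕ in atTop, ∫ z : Fin n → EuclideanSpace ℝ (Fin d) × 𝒴,
      ∫ w, |(1 / n : ℝ) * ∑ i, jointKernel K (h n) (z i) w - jointDensity P w.1 w.2|
        ∂(volume.prod Measure.count) ∂(Measure.pi fun _ => P) ≤ t := by
  have hK : Integrable K := Integrable.of_integral_ne_zero (by rw [hK1]; norm_num)
  have hp := integrable_jointDensity (P := P)
  -- The five error terms carry the weights 2, 1, 1, 2 and 3, so bounds of `t / 10` add up to `9 t /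
  -- 10`.
  obtain ⟨M, hM0, hM⟩ := exists_integral_sub_min_le hK hK0 (δ := t / 10) (by positivity)
  obtain ⟨B, hB, hBf, hBp⟩ := exists_setIntegral_compl_le hp (δ := t / 10) (by positivity)
  set b := ((volume : Measure (EuclideanSpace ℝ (Fin d))).prod
    (Measure.count (α := 𝒴))).real B with hb
  have hb0 : 0 ≤ b := measureReal_nonneg
  -- The summand 1 avoids division by zero when `B` is null.
  set η : ℝ := t / 10 / (b + 1) with hη
  have hη0 : 0 < η := by positivity
  have hηb : η * b ≤ t / 10 := by
    rw [hη, div_mul_eq_mul_div, div_le_iff₀ (by positivity)]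
    nlinarith
  have hvar : Tendsto (fun n : ℕ => M / (4 * η) / (n * h n ^ d)) atTop (𝓝 0) :=
    hnh.const_div_atTop _
  have hbias := tendsto_bias hac hKm hK0 hK1 hh hh0
  filter_upwards [hvar.eventually (ge_mem_nhds (show 0 < t / 10 by positivity)),
    hbias.eventually (ge_mem_nhds (show 0 < t / 10 by positivity)), eventually_gt_atTop 0]
    with n hn1 hn2 hn0
  have hd : 0 < h n ^ d := pow_pos (hh n) d
  have hn' : (0 : ℝ) < n := by exact_mod_cast hn0
  have hδ : ∀ a : EuclideanSpace ℝ (Fin d) × 𝒴, ∫ w, (jointKernel K (h n) a w -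
      min (jointKernel K (h n) a w) (M / h n ^ d)) ∂(volume.prod Measure.count) ≤ t / 10 := by
    intro a
    simp_rw [jointKernel_sub_min hM0 (hh n)]
    have hKM : Integrable fun u => K u - min (K u) M :=
      hK.mono' (by fun_prop) (Eventually.of_forall fun u => by
        have h1 : 0 ≤ min (K u) M := le_min (hK0 u) hM0
        rw [Real.norm_eq_abs, abs_of_nonneg (sub_nonneg.2 (min_le_left _ _))]
        linarith)
    rw [integral_jointKernel (by fun_prop) hKM (hh n)]
    exact hM
  have hmain := integral_integral_abs_average_sub_le (P := P)
    (ν := (volume : Measure (EuclideanSpace ℝ (Fin d))).prod (Measure.count (α := 𝒴)))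
    (measurable_jointKernel hKm (h n))
    (fun a w => jointKernel_nonneg hK0 (hh n) a w) (integrable_jointKernel hKm hK (hh n))
    (fun a => (integral_jointKernel hKm hK (hh n) a).trans hK1) hp
    (div_nonneg hM0 hd.le) hη0 hδ hB hBf hn0
  have hC : M / h n ^ d / (4 * η * n) = M / (4 * η) / (n * h n ^ d) := by
    field_simp
  rw [hC] at hmain
  linarith

end SmoothingKernel

/-! ### Lipschitz dependence of the distance on the density, and the theorem. -/

/-- Replacing the joint density changes the distance to the model by at most the `L¹` distance of
the two densities. -/
lemma abs_tvd_modelJoint_sub_le {d : ℕ} {𝒴 : Type*} [Fintype 𝒴]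
    {𝒳 : Set (EuclideanSpace ℝ (Fin d))} (h𝒳 : MeasurableSet 𝒳)
    {f : 𝒴 → EuclideanSpace ℝ (Fin d) → ℝ} (hfm : ∀ y, Measurable (f y))
    (hf0 : ∀ y, ∀ x ∈ 𝒳, 0 ≤ f y x) (hf1 : ∀ x ∈ 𝒳, ∑ y, f y x = 1)
    {g g' : EuclideanSpace ℝ (Fin d) → 𝒴 → ℝ} (hg : ∀ y, Integrable fun x => g x y)
    (hg' : ∀ y, Integrable fun x => g' x y) :
    |tvd 𝒳 g (modelJoint f g) - tvd 𝒳 g' (modelJoint f g')| ≤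
      ∑ y, ∫ x, |g x y - g' x y| := by
  have hfle : ∀ y, ∀ᵐ x ∂(volume.restrict 𝒳), ‖f y x‖ ≤ 1 := fun y => by
    filter_upwards [ae_restrict_mem h𝒳] with x hx
    rw [Real.norm_eq_abs, abs_of_nonneg (hf0 y x hx), ← hf1 x hx]
    exact Finset.single_le_sum (f := fun y => f y x) (fun y _ => hf0 y x hx) (Finset.mem_univ y)
  have hmul : ∀ (y : 𝒴) {φ : EuclideanSpace ℝ (Fin d) → ℝ}, Integrable φ →
      IntegrableOn (fun x => f y x * φ x) 𝒳 := fun y φ hφ =>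
    hφ.integrableOn.bdd_mul (hfm y).aestronglyMeasurable (hfle y)
  have hres : ∀ {q : EuclideanSpace ℝ (Fin d) → 𝒴 → ℝ}, (∀ y, Integrable fun x => q x y) →
      ∀ y, IntegrableOn (fun x => |q x y - modelJoint f q x y|) 𝒳 := fun {q} hq y =>
    ((hq y).integrableOn.sub (hmul y (integrable_finsetSum _ fun y _ => hq y))).abs
  have hD : ∀ y, Integrable fun x => |g x y - g' x y| := fun y => ((hg y).sub (hg' y)).abs
  have hDs : Integrable fun x => ∑ y, |g x y - g' x y| := integrable_finsetSum _ fun y _ => hD y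
  have hpt : ∀ y, |(∫ x in 𝒳, |g x y - modelJoint f g x y|)
      - (∫ x in 𝒳, |g' x y - modelJoint f g' x y|)| ≤
      (∫ x in 𝒳, |g x y - g' x y|) + ∫ x in 𝒳, f y x * ∑ y', |g x y' - g' x y'| := by
    intro y
    rw [← integral_sub (hres hg y) (hres hg' y), ← integral_add (hD y).integrableOn (hmul y hDs)]
    refine abs_integral_le_integral_abs.trans ?_
    refine setIntegral_mono_on ((hres hg y).sub (hres hg' y)).abs
      ((hD y).integrableOn.add (hmul y hDs)) h𝒳 fun x hx => ?_
    refine (abs_abs_sub_abs_le _ _).trans ?_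
    have h1 : g x y - modelJoint f g x y - (g' x y - modelJoint f g' x y) =
        (g x y - g' x y) - f y x * ∑ y', (g x y' - g' x y') := by
      simp only [modelJoint, xMarginal, Finset.sum_sub_distrib]
      ring
    rw [h1]
    refine (abs_sub _ _).trans (add_le_add le_rfl ?_)
    rw [abs_mul, abs_of_nonneg (hf0 y x hx)]
    exact mul_le_mul_of_nonneg_left (Finset.abs_sum_le_sum_abs _ _) (hf0 y x hx)
  -- Summed over labels, the weights `f y x` disappear, so the change of the model density costs no
  -- more than the change of `g` itself.
  have hmass : ∑ y, ∫ x in 𝒳, f y x * ∑ y', |g x y' - g' x y'| =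
      ∑ y, ∫ x in 𝒳, |g x y - g' x y| := by
    rw [← integral_finsetSum _ fun y _ => hmul y hDs,
      ← integral_finsetSum _ fun y _ => (hD y).integrableOn]
    refine setIntegral_congr_fun h𝒳 fun x hx => ?_
    rw [← Finset.sum_mul, hf1 x hx, one_mul]
  have hle : ∑ y, ∫ x in 𝒳, |g x y - g' x y| ≤ ∑ y, ∫ x, |g x y - g' x y| :=
    Finset.sum_le_sum fun y _ => setIntegral_le_integral (hD y)
      (Eventually.of_forall fun x => abs_nonneg _)
  rw [tvd, tvd, ← mul_sub, ← Finset.sum_sub_distrib, abs_mul,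
    abs_of_nonneg (by norm_num : (0 : ℝ) ≤ 1 / 2)]
  have hsum := (Finset.abs_sum_le_sum_abs (fun y => (∫ x in 𝒳, |g x y - modelJoint f g x y|)
      - ∫ x in 𝒳, |g' x y - modelJoint f g' x y|) Finset.univ).trans
    (Finset.sum_le_sum fun y _ => hpt y)
  rw [Finset.sum_add_distrib, hmass] at hsum
  linarith

/-- The label `ys 0` witnesses that the infimum is not over an empty type. -/
lemma minLabelCount_le {𝒴 : Type*} (n : ℕ) (ys : ℕ → 𝒴) : minLabelCount n ys ≤ n := by
  classical
  refine (ciInf_le (OrderBot.bddBelow _) (ys 0)).trans ?_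
  rw [labelCount]
  exact (Finset.card_filter_le _ _).trans (Finset.card_range n).le

/-- Subadditivity suffices, so `S` need not be measurable. -/
lemma one_sub_measureReal_compl_le {Ω : Type*} [MeasurableSpace Ω] (μ : Measure Ω)
    [IsProbabilityMeasure μ] (S : Set Ω) : 1 - μ.real Sᶜ ≤ μ.real S := by
  have h := measureReal_union_le (μ := μ) S Sᶜ
  rw [Set.union_compl_self, probReal_univ] at h
  linarith

theorem proposition3 (Ky : ℕ) :
    ∃ r : ℝ, 0 < r ∧
      ∀ (d : ℕ) (𝒳 : Set (EuclideanSpace ℝ (Fin d))) (_ : MeasurableSet 𝒳)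
        (𝒴 : Type*) [Fintype 𝒴] [MeasurableSpace 𝒴] [MeasurableSingletonClass 𝒴]
        (_ : Fintype.card 𝒴 = Ky)
        -- the data-generating law, with `x` in `𝒳` having a Lebesgue density
        (P : Measure (EuclideanSpace ℝ (Fin d) × 𝒴)) [IsProbabilityMeasure P]
        (_ : ∀ᵐ z ∂P, z.1 ∈ 𝒳)
        (_ : P.map Prod.fst ≪ (volume : Measure (EuclideanSpace ℝ (Fin d))))
        -- an i.i.d. sample from `P`
        (Ω : Type*) [MeasurableSpace Ω] (μ : Measure Ω) [IsProbabilityMeasure μ]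
        (X : ℕ → Ω → EuclideanSpace ℝ (Fin d)) (Y : ℕ → Ω → 𝒴)
        (_ : ∀ i, Measurable (X i)) (_ : ∀ i, Measurable (Y i))
        (_ : iIndepFun (fun i ω => (X i ω, Y i ω)) μ)
        (_ : ∀ i, μ.map (fun ω => (X i ω, Y i ω)) = P)
        -- the model: conditional probability mass functions `f θ y x = f_θ(y|x)`
        (Θ : Type*) (f : Θ → 𝒴 → EuclideanSpace ℝ (Fin d) → ℝ)
        (_ : ∀ θ y, Measurable (f θ y))
        (_ : ∀ θ y, ∀ x ∈ 𝒳, 0 ≤ f θ y x)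
        (_ : ∀ θ, ∀ x ∈ 𝒳, ∑ y, f θ y x = 1)
        -- the smoothing kernel and the bandwidths
        (K : EuclideanSpace ℝ (Fin d) → ℝ) (_ : Measurable K) (_ : ∀ x, 0 ≤ K x)
        (_ : ∫ x, K x = 1)
        (h : ℕ → ℝ) (_ : ∀ n, 0 < h n) (_ : Tendsto h atTop (𝓝 0))
        (_ : Tendsto (fun n : ℕ => (n : ℝ) * h n ^ d) atTop atTop),
        ∀ ε : ℝ, 0 < ε → ∃ N : ℕ, ∀ n : ℕ, N ≤ n → ∀ θ : Θ, ∀ ω₀ : Ω,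
          1 - Real.exp (-((minLabelCount n (fun i => Y i ω₀) : ℝ) * ε ^ 2 * r)) ≤
            μ.real {ω | |tvd 𝒳 (kde K (h n) n (fun i => X i ω) (fun i => Y i ω))
                  (modelJoint (f θ) (kde K (h n) n (fun i => X i ω) (fun i => Y i ω)))
                - tvd 𝒳 (jointDensity P) (modelJoint (f θ) (jointDensity P))| < ε} := by
  -- The exponent `n t² / 2` at `t = ε / 2` is `n ε² / 8`.
  refine ⟨1 / 8, by norm_num, ?_⟩
  intro d 𝒳 h𝒳 𝒴 _ _ _ _ P _ _ hac Ω _ μ _ X Y hX hY hind hlaw Θ f hfm hf0 hf1 K hKm hK0 hK1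
    h hh hh0 hnh ε hε
  have hK : Integrable K := Integrable.of_integral_ne_zero (by rw [hK1]; norm_num)
  have hp := integrable_jointDensity (P := P)
  obtain ⟨N, hN⟩ := eventually_atTop.1
    (eventually_integral_error_le hac hKm hK0 hK1 hh hh0 hnh (half_pos hε))
  -- `N` comes from the estimator's error alone, hence is uniform in `θ` and `ω₀`; the 1 ensures `n
  -- > 0`.
  refine ⟨max N 1, fun n hn θ ω₀ => ?_⟩
  have hn0 : 0 < n := lt_of_lt_of_le one_pos ((le_max_right _ _).trans hn)
  set Z : Ω → Fin n → EuclideanSpace ℝ (Fin d) × 𝒴 := fun ω i => (X i ω, Y i ω) with hZ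
  have hZm : Measurable Z := measurable_pi_lambda _ fun i => (hX i).prodMk (hY i)
  have hZlaw : μ.map Z = Measure.pi fun _ => P := by
    have hind' : iIndepFun (fun (i : Fin n) ω => (X i ω, Y i ω)) μ :=
      hind.precomp (g := fun i : Fin n => (i : ℕ)) Fin.val_injective
    rw [hZ, hind'.map_fun_eq_pi_map fun i : Fin n => ((hX i).prodMk (hY i)).aemeasurable]
    simp_rw [hlaw]
  set F : (Fin n → EuclideanSpace ℝ (Fin d) × 𝒴) → ℝ := fun z =>
    ∫ w, |(1 / n : ℝ) * ∑ i, jointKernel K (h n) (z i) w - jointDensity P w.1 w.2|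
      ∂(volume.prod Measure.count) with hF
  have hconc := measureReal_integral_abs_average_sub_le (P := P)
    (measurable_jointKernel hKm (h n)) (fun a w => jointKernel_nonneg hK0 (hh n) a w)
    (integrable_jointKernel hKm hK (hh n))
    (fun a => (integral_jointKernel hKm hK (hh n) a).trans hK1) measurable_jointDensity hp hn0
    (half_pos hε).le (hN n ((le_max_left _ _).trans hn))
  have hbad : μ.real {ω | ε ≤ F (Z ω)} ≤ Real.exp (-(n * (ε / 2) ^ 2 / 2)) := by
    refine le_trans ?_ hconc
    rw [← hZlaw]
    have h2 : (2 : ℝ) * (ε / 2) = ε := by ring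
    rw [h2]
    refine ENNReal.toReal_mono (measure_ne_top _ _) ?_
    exact Measure.le_map_apply hZm.aemeasurable _
  have hexp : Real.exp (-(n * (ε / 2) ^ 2 / 2)) ≤
      Real.exp (-((minLabelCount n (fun i => Y i ω₀) : ℝ) * ε ^ 2 * (1 / 8))) := by
    refine Real.exp_le_exp.2 ?_
    have hmin : (minLabelCount n (fun i => Y i ω₀) : ℝ) ≤ n := by
      exact_mod_cast minLabelCount_le n _
    nlinarith [mul_le_mul_of_nonneg_right hmin (sq_nonneg ε)]
  refine le_trans (sub_le_sub_left ?_ 1) (one_sub_measureReal_compl_le μ _)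
  refine le_trans (measureReal_mono fun ω hω => ?_) (hbad.trans hexp)
  have hω' : ε ≤ |tvd 𝒳 (kde K (h n) n (fun i => X i ω) (fun i => Y i ω))
      (modelJoint (f θ) (kde K (h n) n (fun i => X i ω) (fun i => Y i ω)))
      - tvd 𝒳 (jointDensity P) (modelJoint (f θ) (jointDensity P))| := not_lt.1 hω
  refine hω'.trans ?_
  have hkde : Integrable (fun w : EuclideanSpace ℝ (Fin d) × 𝒴 =>
      kde K (h n) n (fun i => X i ω) (fun i => Y i ω) w.1 w.2) (volume.prod Measure.count) := by
    simp_rw [kde_eq_average]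
    exact (integrable_finsetSum _ fun (i : Fin n) _ =>
      integrable_jointKernel hKm hK (hh n) (X i ω, Y i ω)).const_mul _
  refine (abs_tvd_modelJoint_sub_le h𝒳 (hfm θ) (hf0 θ) (hf1 θ)
    (integrable_section_of_prod_count hkde) (integrable_section_of_prod_count hp)).trans
    (le_of_eq ?_)
  have hdiff : Integrable (fun w : EuclideanSpace ℝ (Fin d) × 𝒴 =>
      |kde K (h n) n (fun i => X i ω) (fun i => Y i ω) w.1 w.2 - jointDensity P w.1 w.2|)
      (volume.prod Measure.count) := (hkde.sub hp).abs
  refine (integral_prod_count hdiff).symm.trans ?_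
  simp only [kde_eq_average]
  rfl
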